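/- Let $K$ be a number field of degree $k$ and let $B=(\omega_1,\dots,\omega_k)$ be a basis of $K$ over $\mathbb{Q}$. For $q\in K$ let $A_{K,B}(q)\in M_{k\times k}(\mathbb{Q})$ be the matrix of multiplication by $q$ with respect to $B$, and let $A^*_{K,B}:\mathbb{R}^k\to M_{k\times k}(\mathbb{R})$, $A^*_{K,B}(x)=\sum_j x_jA_{K,B}(\omega_j)$. Its image, denoted $(\mathbb{R}\otimes_{\mathbb{Q}}K)_B$, is a commutative $\mathbb{R}$-algebra, and $A^*_{K,B}$ is injective. Let $\Sigma$ be the set of field embeddings $\sigma:K\to\mathbb{C}$. For $\sigma\in\Sigma$ let $\sigma^*:(\mathbb{R}\otimes_{\mathbb{Q}}K)_B\to\mathbb{C}$ be the ring homomorphism that extends $A_{K,B}(q)\mapsto\sigma(q)$ by continuity, and let $\sigma^{**}=\sigma^*\circ A^*_{K,B}$, so that $\sigma^{**}(x)=\sum_j x_j\sigma(\omega_j)$ for $x\in\mathbb{R}^k$. For $\mathbf{x}=(x_1,\dots,x_n)\in(\mathbb{R}^k)^n=\mathbb{R}^{nk}$ put $\vec\sigma(\mathbf{x})=(\sigma^{**}(x_1),\dots,\sigma^{**}(x_n))\in\mathbb{C}^n$.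 For a polynomial $f$ in $n$ variables over $(\mathbb{R}\otimes_{\mathbb{Q}}K)_B$, let $P_{f,\sigma}\in\mathbb{C}[z_1,\dots,z_n]$ be the polynomial obtained by applying $\sigma^*$ to each coefficient of $f$. For all $K$, $B$, $d$, $n$ there is a constant $C=C_{K,B,d,n}>0$ with the following property. Let $f$ be a polynomial in $n$ variables of degree at most $d$ with coefficients in $(\mathbb{R}\otimes_{\mathbb{Q}}K)_B$, and let $S\subset\Sigma$ be such that $\sigma\in S$ implies $\overline\sigma\in S$. For each $\sigma\in S$ let $0<\epsilon_\sigma<\mu_\sigma$ be real numbers and let $\alpha_\sigma\in\mathbb{Z}_{\ge0}^n$ be a multi-index. Then the set $$A=\left\{\mathbf{x}\in[0,1]^{nk}:\ |\nabla P_{f,\sigma}(\vec\sigma(\mathbf{x}))|\le\epsilon_\sigma\ \text{ and }\ |\partial^{\alpha_\sigma}P_{f,\sigma}(\vec\sigma(\mathbf{x}))|\ge\mu_\sigma\ \text{ for all }\sigma\in S\right\}$$ has Lebesgue measure $$|A|\le C\prod_{\sigma\in S}\left(\frac{\epsilon_\sigma}{\mu_\sigma}\right)^{1/(|\alpha_\sigma|-1)},$$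 where $\nabla$ and $\partial^{\alpha}$ are complex (holomorphic) derivatives, $|\nabla P|$ is the Euclidean norm of the gradient, and a factor with $|\alpha_\sigma|=1$ is read as $(\epsilon_\sigma/\mu_\sigma)^{+\infty}=0$. -/

import Mathlib

noncomputable section

namespace NumberFieldSublevel

variable {K : Type*} [Field K] [NumberField K]
variable {ι : Type*} [Fintype ι]

/-- The map `σ** : ℝ^k → ℂ`, `σ**(x) = x_1 σ(ω_1) + ⋯ + x_k σ(ω_k)`. It equals `σ* ∘ A*_{K,B}`,
see `sigmaStar_mulMatrixStar`. -/
def sigmaStarStar (B : Module.Basis ι ℚ K) (σ : K →+* ℂ) (x : ι → ℝ) : ℂ :=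
  ∑ j, (x j : ℂ) * σ (B j)

lemma sigmaStarStar_repr (B : Module.Basis ι ℚ K) (σ : K →+* ℂ) (q : K) :
    sigmaStarStar B σ (fun j => (B.repr q j : ℝ)) = σ q := by
  conv_rhs => rw [← B.sum_repr q]
  simp [sigmaStarStar, Algebra.smul_def]

/-- The bilinear product on `ℝ^k` induced by multiplication in `K`. -/
def coordMul (B : Module.Basis ι ℚ K) (x y : ι → ℝ) : ι → ℝ :=
  fun l => ∑ i, ∑ j, x i * y j * (B.repr (B i * B j) l : ℝ)

lemma sigmaStarStar_coordMul (B : Module.Basis ι ℚ K) (σ : K →+* ℂ) (x y : ι → ℝ) :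
    sigmaStarStar B σ (coordMul B x y) = sigmaStarStar B σ x * sigmaStarStar B σ y := by
  have h : ∀ i j, ∑ l, ((B.repr (B i * B j) l : ℝ) : ℂ) * σ (B l) = σ (B i) * σ (B j) := by
    intro i j
    exact (sigmaStarStar_repr B σ (B i * B j)).trans (map_mul σ _ _)
  simp only [sigmaStarStar, coordMul, Complex.ofReal_sum, Complex.ofReal_mul, Finset.sum_mul]
  rw [Finset.sum_comm]
  refine Finset.sum_congr rfl fun i _ => ?_
  rw [Finset.sum_comm, Finset.mul_sum]
  refine Finset.sum_congr rfl fun j _ => ?_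
  simp only [mul_assoc]
  rw [← Finset.mul_sum, ← Finset.mul_sum, h]
  ring

variable [DecidableEq ι]

/-- The matrix `A_{K,B}(q)` of multiplication by `q` with respect to the basis `B`, viewed as a
real matrix. -/
def mulMatrix (B : Module.Basis ι ℚ K) (q : K) : Matrix ι ι ℝ :=
  (Algebra.leftMulMatrix B q).map (algebraMap ℚ ℝ)

/-- The continuous (that is, real-linear) extension `A*_{K,B} : ℝ^k → M_{k×k}(ℝ)` of the map
`(q_1, …, q_k) ↦ A_{K,B}(q_1 ω_1 + ⋯ + q_k ω_k)`, where `B = (ω_j)`. -/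
def mulMatrixStar (B : Module.Basis ι ℚ K) : (ι → ℝ) →ₗ[ℝ] Matrix ι ι ℝ where
  toFun x := ∑ j, x j • mulMatrix B (B j)
  map_add' x y := by simp [add_smul, Finset.sum_add_distrib]
  map_smul' c x := by simp [mul_smul, Finset.smul_sum]

lemma mulMatrixStar_apply (B : Module.Basis ι ℚ K) (x : ι → ℝ) :
    mulMatrixStar B x = ∑ j, x j • mulMatrix B (B j) := rfl

lemma mulMatrixStar_repr (B : Module.Basis ι ℚ K) (q : K) :
    mulMatrixStar B (fun j => (B.repr q j : ℝ)) = mulMatrix B q := by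
  ext a b
  have h : Algebra.leftMulMatrix B q a b
      = ∑ j, B.repr q j * Algebra.leftMulMatrix B (B j) a b := by
    conv_lhs => rw [← B.sum_repr q]
    simp only [map_sum, map_smul, Matrix.sum_apply, Matrix.smul_apply, smul_eq_mul]
  simp [mulMatrixStar_apply, mulMatrix, Matrix.sum_apply, h]

lemma mulMatrix_mul (B : Module.Basis ι ℚ K) (p q : K) :
    mulMatrix B (p * q) = mulMatrix B p * mulMatrix B q := by
  simp [mulMatrix, Matrix.map_mul]

lemma mulMatrix_one (B : Module.Basis ι ℚ K) : mulMatrix B 1 = 1 := by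
  simp [mulMatrix]

/-- Applying `A*_{K,B}(x)` to the coordinates of `1` gives back `x`. -/
lemma mulMatrixStar_mulVec (B : Module.Basis ι ℚ K) (x : ι → ℝ) :
    (mulMatrixStar B x).mulVec (fun j => (B.repr 1 j : ℝ)) = x := by
  have h : ∀ q : K, (mulMatrix B q).mulVec (fun j => (B.repr 1 j : ℝ))
      = fun i => (B.repr q i : ℝ) := by
    intro q
    have h1 := Algebra.leftMulMatrix_mulVec_repr B q 1
    rw [mul_one] at h1
    funext i
    rw [← h1]
    simp [mulMatrix, Matrix.mulVec, dotProduct]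
  rw [mulMatrixStar_apply, Matrix.sum_mulVec]
  simp only [Matrix.smul_mulVec, h]
  funext i
  simp [Finset.sum_apply, Finsupp.single_apply, apply_ite (Rat.cast : ℚ → ℝ)]

lemma mulMatrixStar_injective (B : Module.Basis ι ℚ K) :
    Function.Injective (mulMatrixStar B) := by
  intro x y h
  rw [← mulMatrixStar_mulVec B x, h, mulMatrixStar_mulVec]

lemma mulMatrixStar_mul (B : Module.Basis ι ℚ K) (x y : ι → ℝ) :
    mulMatrixStar B x * mulMatrixStar B y
      = mulMatrixStar B (coordMul B x y) := by
  have h : coordMul B x y = ∑ i, ∑ j, (x i * y j) • fun l => (B.repr (B i * B j) l : ℝ) := by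
    funext l
    simp [coordMul, Finset.sum_apply]
  rw [h]
  simp only [map_sum, map_smul, mulMatrixStar_repr, mulMatrix_mul]
  simp only [mulMatrixStar_apply, Finset.sum_mul_sum, smul_mul_smul_comm]

/-- The algebra `(ℝ ⊗ K)_B`: the image of `ℝ^k` under `A*_{K,B}`. -/
def realTensor (B : Module.Basis ι ℚ K) : Subalgebra ℝ (Matrix ι ι ℝ) where
  carrier := Set.range (mulMatrixStar B)
  mul_mem' := by
    rintro _ _ ⟨x, rfl⟩ ⟨y, rfl⟩
    exact ⟨_, (mulMatrixStar_mul B x y).symm⟩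
  add_mem' := by
    rintro _ _ ⟨x, rfl⟩ ⟨y, rfl⟩
    exact ⟨x + y, map_add _ x y⟩
  algebraMap_mem' r := by
    refine ⟨r • fun j => (B.repr 1 j : ℝ), ?_⟩
    rw [map_smul, mulMatrixStar_repr, mulMatrix_one, Algebra.algebraMap_eq_smul_one]

instance realTensorCommRing (B : Module.Basis ι ℚ K) : CommRing (realTensor B) where
  __ := (realTensor B).toRing
  mul_comm := by
    rintro ⟨_, x, rfl⟩ ⟨_, y, rfl⟩
    refine Subtype.ext ?_
    change mulMatrixStar B x * mulMatrixStar B y = mulMatrixStar B y * mulMatrixStar B x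
    have h : coordMul B x y = coordMul B y x := by
      funext l
      simp only [coordMul]
      rw [Finset.sum_comm]
      refine Finset.sum_congr rfl fun i _ => Finset.sum_congr rfl fun j _ => ?_
      rw [mul_comm (x j), mul_comm (B j)]
    rw [mulMatrixStar_mul, mulMatrixStar_mul, h]

/-- The unique `x ∈ ℝ^k` with `A*_{K,B}(x) = M`. -/
def coords (B : Module.Basis ι ℚ K) (M : realTensor B) : ι → ℝ :=
  Classical.choose M.2

lemma mulMatrixStar_coords (B : Module.Basis ι ℚ K) (M : realTensor B) :
    mulMatrixStar B (coords B M) = M :=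
  Classical.choose_spec M.2

lemma coords_eq (B : Module.Basis ι ℚ K) (M : realTensor B) (x : ι → ℝ)
    (h : mulMatrixStar B x = M) : coords B M = x :=
  mulMatrixStar_injective B ((mulMatrixStar_coords B M).trans h.symm)

/-- The ring homomorphism `σ* : (ℝ ⊗ K)_B → ℂ`, the continuous extension of
`A_{K,B}(q) ↦ σ(q)`, see `sigmaStar_mulMatrix`. -/
def sigmaStar (B : Module.Basis ι ℚ K) (σ : K →+* ℂ) : realTensor B →+* ℂ where
  toFun M := sigmaStarStar B σ (coords B M)
  map_one' := by
    rw [coords_eq B 1 (fun j => (B.repr 1 j : ℝ)), sigmaStarStar_repr, map_one]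
    rw [mulMatrixStar_repr, mulMatrix_one]; rfl
  map_zero' := by
    rw [coords_eq B 0 0 (by rw [map_zero]; rfl)]
    simp [sigmaStarStar]
  map_add' M N := by
    rw [coords_eq B (M + N) (coords B M + coords B N)
      (by rw [map_add, mulMatrixStar_coords, mulMatrixStar_coords]; rfl)]
    simp [sigmaStarStar, add_mul, Finset.sum_add_distrib]
  map_mul' M N := by
    rw [coords_eq B (M * N) (coordMul B (coords B M) (coords B N))
      (by rw [← mulMatrixStar_mul, mulMatrixStar_coords, mulMatrixStar_coords]; rfl)]
    exact sigmaStarStar_coordMul B σ _ _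

lemma sigmaStar_mulMatrixStar (B : Module.Basis ι ℚ K) (σ : K →+* ℂ) (x : ι → ℝ) :
    sigmaStar B σ ⟨mulMatrixStar B x, x, rfl⟩ = sigmaStarStar B σ x :=
  congrArg (sigmaStarStar B σ) (coords_eq B _ x rfl)

lemma sigmaStar_mulMatrix (B : Module.Basis ι ℚ K) (σ : K →+* ℂ) (q : K) :
    sigmaStar B σ ⟨mulMatrix B q, _, mulMatrixStar_repr B q⟩ = σ q := by
  refine (congrArg (sigmaStarStar B σ) (coords_eq B _ _ ?_)).trans (sigmaStarStar_repr B σ q)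
  exact mulMatrixStar_repr B q

/-- The complex polynomial `P_{f,σ}`: apply `σ*` to each coefficient of `f`. -/
def polyAt (B : Module.Basis ι ℚ K) {n : ℕ} (f : MvPolynomial (Fin n) (realTensor B))
    (σ : K →+* ℂ) : MvPolynomial (Fin n) ℂ :=
  MvPolynomial.map (sigmaStar B σ) f

/-- The vector `σ(x) = (σ**(x_1), …, σ**(x_n)) ∈ ℂ^n` for `x ∈ ℝ^{kn}`. -/
def sigmaVec (B : Module.Basis ι ℚ K) {n : ℕ} (σ : K →+* ℂ) (x : Fin n → ι → ℝ) : Fin n → ℂ :=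
  fun l => sigmaStarStar B σ (x l)

/-- The (holomorphic) gradient of a complex polynomial at a point, with the Euclidean norm. -/
def gradient {n : ℕ} (P : MvPolynomial (Fin n) ℂ) (z : Fin n → ℂ) : EuclideanSpace ℂ (Fin n) :=
  WithLp.toLp 2 fun l => MvPolynomial.eval z (MvPolynomial.pderiv l P)

/-- The mixed partial derivative `∂^α P = ∂_1^{α_1} ⋯ ∂_n^{α_n} P`. -/
def partialDeriv {n : ℕ} (α : Fin n → ℕ) (P : MvPolynomial (Fin n) ℂ) : MvPolynomial (Fin n) ℂ :=
  (List.finRange n).foldr (fun l Q => (MvPolynomial.pderiv l)^[α l] Q) P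

/-- The set of points `x` of the unit cube of `ℝ^{nk}` at which, for every `σ ∈ S`, the gradient of
`P_{f,σ}` at `σ(x)` is at most `ε_σ` and its derivative of order `α_σ` at `σ(x)` is at least
`μ_σ`. -/
def sublevelSet (B : Module.Basis ι ℚ K) {n : ℕ} (f : MvPolynomial (Fin n) (realTensor B))
    (S : Finset (K →+* ℂ)) (α : (K →+* ℂ) → Fin n → ℕ) (ε μ : (K →+* ℂ) → ℝ) :
    Set (Fin n → ι → ℝ) :=
  {x | (∀ l j, x l j ∈ Set.Icc (0 : ℝ) 1) ∧ ∀ σ ∈ S,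
    ‖gradient (polyAt B f σ) (sigmaVec B σ x)‖ ≤ ε σ ∧
    μ σ ≤ ‖MvPolynomial.eval (sigmaVec B σ x) (partialDeriv (α σ) (polyAt B f σ))‖}

/-- The factor `t^{1/(m - 1)}` for `0 < t < 1`. For `m = 1`, where the exponent is `1/0 = +∞`, it is
`t^{+∞} = 0`. -/
def decayFactor (t : ℝ) (m : ℕ) : ℝ :=
  if m = 1 then 0 else t ^ (1 / ((m : ℝ) - 1))

end NumberFieldSublevel

end

namespace NumberFieldSublevel

open MeasureTheory

/-! ### Derivatives of polynomials -/

/-! The values at the infinite places w identify ℝ^{nk} linearly with the product of the E_w^n,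
where E_w is ℝ or ℂ (`placeEquiv`). Up to a fixed Jacobian, the measure is thus at most a product
over places, and each place needs a bound of order (ε/μ)^{dim E_w/(|α|-1)} (`volume_gradient_le`).
At a complex place the doubled exponent pays for both σ and its conjugate, even if their data
differ: the square of the smaller factor is at most the product
(`le_mul_prod_of_forall_le_mul_pow`).

At one place, ∂^α P arises from some ∂_l P, of size at most ε, by s = |α|-1 further derivatives. To
climb from ε to μ, one of these steps must enlarge the absolute value by a factor of order
(μ/ε)^{1/s}. On a coordinate line, q'/q is the sum of 1/(t-ρ) over the roots ρ, so |q'| > c|q|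
forces t to lie within deg q / c of a root, a set of measure O(c^{-dim E}). Fubini handles the other
coordinates. -/

lemma totalDegree_pderiv_lt {τ R : Type*} [CommSemiring R] (i : τ) (p : MvPolynomial τ R)
    (h : MvPolynomial.pderiv i p ≠ 0) :
    (MvPolynomial.pderiv i p).totalDegree + 1 ≤ p.totalDegree := by
  have key : ∀ m ∈ (MvPolynomial.pderiv i p).support, m.degree + 1 ≤ p.totalDegree := by
    intro m hm
    rw [MvPolynomial.mem_support_iff, MvPolynomial.coeff_pderiv] at hm
    have := MvPolynomial.le_totalDegree
      (MvPolynomial.mem_support_iff.mpr (left_ne_zero_of_mul hm))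
    have h' : Finsupp.degree (m + Finsupp.single i 1) ≤ p.totalDegree := this
    simpa using h'
  obtain ⟨m, hm, hm'⟩ := Finset.exists_mem_eq_sup _ (MvPolynomial.support_nonempty.mpr h)
    (fun s : τ →₀ ℕ => s.degree)
  have : (MvPolynomial.pderiv i p).totalDegree = m.degree := hm' ▸ rfl
  rw [this]
  exact key m hm

/-- Successive partial derivatives in the directions of a list, the last one first. -/
noncomputable def listDeriv {n : ℕ} (ls : List (Fin n)) (P : MvPolynomial (Fin n) ℂ) :
    MvPolynomial (Fin n) ℂ :=
  ls.foldr (fun l Q => MvPolynomial.pderiv l Q) P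

lemma listDeriv_cons {n : ℕ} (l : Fin n) (ls : List (Fin n)) (P : MvPolynomial (Fin n) ℂ) :
    listDeriv (l :: ls) P = MvPolynomial.pderiv l (listDeriv ls P) := rfl

lemma listDeriv_append {n : ℕ} (ls ms : List (Fin n)) (P : MvPolynomial (Fin n) ℂ) :
    listDeriv (ls ++ ms) P = listDeriv ls (listDeriv ms P) := by
  simp [listDeriv]

/-- Each derivative costs a degree, so a nonvanishing chain has length at most the degree. This
keeps the constants independent of α. -/
lemma totalDegree_listDeriv_add_length_le {n : ℕ} (ls : List (Fin n))
    (P : MvPolynomial (Fin n) ℂ) (h : listDeriv ls P ≠ 0) :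
    (listDeriv ls P).totalDegree + ls.length ≤ P.totalDegree := by
  induction ls with
  | nil => simp [listDeriv]
  | cons l ls ih =>
    rw [listDeriv_cons] at h ⊢
    have h1 := totalDegree_pderiv_lt l _ h
    have h2 := ih (fun h0 => h (by rw [h0, map_zero]))
    simp only [List.length_cons]
    omega

lemma totalDegree_listDeriv_le {n : ℕ} (ls : List (Fin n)) (P : MvPolynomial (Fin n) ℂ) :
    (listDeriv ls P).totalDegree ≤ P.totalDegree := by
  by_cases h : listDeriv ls P = 0
  · simp [h]
  · have := totalDegree_listDeriv_add_length_le ls P h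
    omega

lemma exists_partialDeriv_eq_listDeriv {n : ℕ} (α : Fin n → ℕ) :
    ∃ ls : List (Fin n), ls.length = ∑ l, α l ∧ ∀ P, partialDeriv α P = listDeriv ls P := by
  have iter : ∀ (k : ℕ) (l : Fin n) (P : MvPolynomial (Fin n) ℂ),
      (MvPolynomial.pderiv l)^[k] P = listDeriv (List.replicate k l) P := by
    intro k l P
    induction k with
    | zero => rfl
    | succ k ih => rw [Function.iterate_succ_apply', ih]; rfl
  refine ⟨(List.finRange n).flatMap fun l => List.replicate (α l) l, ?_, fun P => ?_⟩
  · rw [List.length_flatMap]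
    simp [List.sum_ofFn, ← List.ofFn_eq_map]
  · unfold partialDeriv
    induction List.finRange n with
    | nil => rfl
    | cons a as ih => rw [List.foldr_cons, ih, iter, List.flatMap_cons, listDeriv_append]

/-! ### Restriction to coordinate lines and roots -/

/-- The restriction of a polynomial to a line parallel to the `l`-th coordinate axis. -/
noncomputable def restrictLine {n : ℕ} (l : Fin n) (z : Fin n → ℂ) (P : MvPolynomial (Fin n) ℂ) :
    Polynomial ℂ :=
  MvPolynomial.aeval (Function.update (fun j => Polynomial.C (z j)) l Polynomial.X) P

lemma eval_restrictLine {n : ℕ} (l : Fin n) (z : Fin n → ℂ) (P : MvPolynomial (Fin n) ℂ)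
    (t : ℂ) :
    (restrictLine l z P).eval t = MvPolynomial.eval (Function.update z l t) P := by
  have h : (Polynomial.aeval t).comp
      (MvPolynomial.aeval (Function.update (fun j => Polynomial.C (z j)) l Polynomial.X)) =
      (MvPolynomial.aeval (Function.update z l t) : MvPolynomial (Fin n) ℂ →ₐ[ℂ] ℂ) := by
    refine MvPolynomial.algHom_ext fun j => ?_
    by_cases hj : j = l
    · subst hj; simp
    · simp [hj]
  have := DFunLike.congr_fun h P
  simpa [restrictLine, MvPolynomial.aeval_eq_eval, Polynomial.coe_aeval_eq_eval] using this

lemma derivative_restrictLine {n : ℕ} (l : Fin n) (z : Fin n → ℂ)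
    (P : MvPolynomial (Fin n) ℂ) :
    Polynomial.derivative (restrictLine l z P) =
      restrictLine l z (MvPolynomial.pderiv l P) := by
  induction P using MvPolynomial.induction_on with
  | C a => simp [restrictLine]
  | add p q hp hq => simp only [restrictLine, map_add] at *; rw [hp, hq]
  | mul_X p j hp =>
    simp only [restrictLine, map_mul, MvPolynomial.pderiv_mul, map_add,
      Polynomial.derivative_mul] at *
    rw [hp]
    by_cases hj : j = l
    · subst hj; simp
    · simp [hj, MvPolynomial.pderiv_X_of_ne hj]

lemma natDegree_restrictLine_le {n : ℕ} (l : Fin n) (z : Fin n → ℂ)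
    (P : MvPolynomial (Fin n) ℂ) : (restrictLine l z P).natDegree ≤ P.totalDegree := by
  have := MvPolynomial.aeval_natDegree_le (n := 1) P le_rfl
    (Function.update (fun j => Polynomial.C (z j)) l Polynomial.X) (fun j => by
      by_cases hj : j = l
      · subst hj; simp
      · simp [hj])
  simpa [restrictLine] using this

/-- Where the logarithmic derivative of a polynomial is large there is a root nearby. -/
lemma exists_root_near_of_lt_norm_derivative (q : Polynomial ℂ) (c : ℝ) (hc : 0 < c) (t : ℂ)
    (h : c * ‖q.eval t‖ < ‖q.derivative.eval t‖) :
    ∃ ρ ∈ q.roots.toFinset, ‖t - ρ‖ ≤ q.natDegree / c := by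
  have hq : q ≠ 0 := by rintro rfl; simp at h
  by_contra! hfar
  have hroot : q.eval t ≠ 0 := by
    intro h0
    have := hfar t (by simp [hq, h0])
    rw [sub_self, norm_zero] at this
    exact absurd this (not_lt.mpr (by positivity))
  have hdeg : 0 < q.natDegree := by
    by_contra! h0
    rw [Polynomial.eq_C_of_natDegree_le_zero h0] at h
    simp only [Polynomial.eval_C, Polynomial.derivative_C, Polynomial.eval_zero, norm_zero] at h
    exact absurd h (not_lt.mpr (by positivity))
  -- The logarithmic derivative is the sum of 1/(t-ρ) over the roots with multiplicity; if all roots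
  -- are far, each term is at most c / deg q.
  have hlog := (IsAlgClosed.splits q).eval_derivative_div_eval_of_ne_zero hroot
  have hle : ‖q.derivative.eval t / q.eval t‖ ≤ c := by
    rw [hlog]
    refine (norm_multiset_sum_le _).trans ?_
    rw [Multiset.map_map]
    refine (Multiset.sum_le_card_nsmul _ (c / q.natDegree) ?_).trans ?_
    · intro x hx
      obtain ⟨ρ, hρ, rfl⟩ := Multiset.mem_map.mp hx
      have h1 := hfar ρ (Multiset.mem_toFinset.mpr hρ)
      have h2 : (0 : ℝ) < q.natDegree / c := by positivity
      simp only [Function.comp_apply, norm_div, norm_one]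
      rw [div_le_iff₀ (h2.trans h1)]
      calc (1 : ℝ) = c / q.natDegree * (q.natDegree / c) := by field_simp
        _ ≤ _ := by gcongr
    · rw [Multiset.card_map, nsmul_eq_mul]
      have h1 : (q.roots.card : ℝ) ≤ q.natDegree := by exact_mod_cast q.card_roots'
      calc (q.roots.card : ℝ) * (c / q.natDegree) ≤ q.natDegree * (c / q.natDegree) := by gcongr
        _ = c := by field_simp
  rw [norm_div, div_le_iff₀ (norm_pos_iff.mpr hroot)] at hle
  exact absurd h (not_lt.mpr hle)

/-! ### Sublevel estimates on a real subspace of `ℂ` -/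

/-- The bound for the measure of the set of points of a line at which the logarithmic derivative
of a polynomial of degree at most `d` is larger than `c`. -/
noncomputable def lineBound (E : Submodule ℝ ℂ) (d : ℕ) (c : ℝ) : ENNReal :=
  d * (ENNReal.ofReal ((2 * (d / c)) ^ Module.finrank ℝ E) * volume (Metric.closedBall (0 : E) 1))

/-- The root ρ need not lie in E. Recentring at a point of E within r of ρ doubles the radius. -/
lemma volume_setOf_dist_le (E : Submodule ℝ ℂ) (ρ : ℂ) (r : ℝ) (hr : 0 ≤ r) :
    volume {t : E | ‖(t : ℂ) - ρ‖ ≤ r} ≤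
      ENNReal.ofReal ((2 * r) ^ Module.finrank ℝ E) * volume (Metric.closedBall (0 : E) 1) := by
  rcases Set.eq_empty_or_nonempty {t : E | ‖(t : ℂ) - ρ‖ ≤ r} with h | ⟨t₀, ht₀⟩
  · rw [h, measure_empty]; exact zero_le
  · rw [← Measure.addHaar_closedBall' volume t₀ (by positivity)]
    refine measure_mono fun t ht => ?_
    rw [Metric.mem_closedBall, dist_eq_norm]
    have : ‖(t : ℂ) - t₀‖ ≤ 2 * r := by
      calc ‖(t : ℂ) - t₀‖ = ‖((t : ℂ) - ρ) - (t₀ - ρ)‖ := by ring_nf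
        _ ≤ ‖(t : ℂ) - ρ‖ + ‖(t₀ : ℂ) - ρ‖ := norm_sub_le _ _
        _ ≤ r + r := add_le_add ht ht₀
        _ = 2 * r := by ring
    exact this

lemma volume_logDeriv_gt_le (E : Submodule ℝ ℂ) (q : Polynomial ℂ) (d : ℕ) (hd : q.natDegree ≤ d)
    (c : ℝ) (hc : 0 < c) :
    volume {t : E | c * ‖q.eval (t : ℂ)‖ < ‖q.derivative.eval (t : ℂ)‖} ≤ lineBound E d c := by
  have hr : (0 : ℝ) ≤ d / c := by positivity
  have hsub : {t : E | c * ‖q.eval (t : ℂ)‖ < ‖q.derivative.eval (t : ℂ)‖} ⊆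
      ⋃ ρ ∈ q.roots.toFinset, {t : E | ‖(t : ℂ) - ρ‖ ≤ d / c} := by
    intro t ht
    obtain ⟨ρ, hρ, hle⟩ := exists_root_near_of_lt_norm_derivative q c hc t ht
    refine Set.mem_biUnion hρ (hle.trans ?_)
    gcongr
  refine (measure_mono hsub).trans ((measure_biUnion_finset_le _ _).trans ?_)
  refine (Finset.sum_le_card_nsmul _ _ _ fun ρ _ => volume_setOf_dist_le E ρ _ hr).trans ?_
  have hroots : q.roots.card ≤ d := q.card_roots'.trans hd
  rw [nsmul_eq_mul, lineBound]
  gcongr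
  exact (Multiset.toFinset_card_le _).trans hroots

/-! ### From lines to polydiscs -/

/-- The bound for the measure of the part of a polydisc where a partial derivative of a polynomial
of degree at most `d` is larger than `c` times the polynomial. -/
noncomputable def boxBound (E : Submodule ℝ ℂ) (d n : ℕ) (R c : ℝ) : ENNReal :=
  lineBound E d c * volume (Metric.closedBall (0 : E) R) ^ (n - 1)

lemma continuous_eval_coe (E : Submodule ℝ ℂ) {n : ℕ} (Q : MvPolynomial (Fin n) ℂ) :
    Continuous fun z : Fin n → E => MvPolynomial.eval (fun j => (z j : ℂ)) Q :=
  (MvPolynomial.continuous_eval Q).comp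
    (continuous_pi fun j => continuous_subtype_val.comp (continuous_apply j))

lemma volume_pderiv_gt_le (E : Submodule ℝ ℂ) {n : ℕ} (Q : MvPolynomial (Fin n) ℂ) (d : ℕ)
    (hd : Q.totalDegree ≤ d) (R c : ℝ) (hc : 0 < c) (l : Fin n) :
    volume {z : Fin n → E | (∀ j, ‖z j‖ ≤ R) ∧
      c * ‖MvPolynomial.eval (fun j => (z j : ℂ)) Q‖ <
        ‖MvPolynomial.eval (fun j => (z j : ℂ)) (MvPolynomial.pderiv l Q)‖} ≤
      boxBound E d n R c := by
  -- With no variables there is no direction `l`; otherwise the exponent `n - 1` in `boxBound` is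
  -- not truncated.
  obtain _ | n := n
  · exact l.elim0
  set T := {z : Fin (n + 1) → E | (∀ j, ‖z j‖ ≤ R) ∧
      c * ‖MvPolynomial.eval (fun j => (z j : ℂ)) Q‖ <
        ‖MvPolynomial.eval (fun j => (z j : ℂ)) (MvPolynomial.pderiv l Q)‖} with hT
  have hTm : MeasurableSet T := by
    have h1 : MeasurableSet {z : Fin (n + 1) → E | ∀ j, ‖z j‖ ≤ R} := by
      simp only [Set.ofPred_forall]
      exact MeasurableSet.iInter fun j => measurableSet_le (by fun_prop) (by fun_prop)
    exact h1.inter (measurableSet_lt ((continuous_eval_coe E Q).norm.const_mul c |>.measurable)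
      (continuous_eval_coe E _).norm.measurable)
  set e := MeasurableEquiv.piFinSuccAbove (fun _ : Fin (n + 1) => E) l with he
  have hmp := volume_preserving_piFinSuccAbove (fun _ : Fin (n + 1) => E) l
  have hvol : volume T = volume (e.symm ⁻¹' T) :=
    ((hmp.symm e).measure_preimage hTm.nullMeasurableSet).symm
  have hslice : ∀ y : Fin n → E, volume ((fun t => (t, y)) ⁻¹' (e.symm ⁻¹' T)) ≤
      (Set.univ.pi fun _ : Fin n => Metric.closedBall (0 : E) R).indicator
        (fun _ => lineBound E d c) y := by
    intro y
    have hmem : ∀ t : E, (t, y) ∈ e.symm ⁻¹' T ↔ l.insertNth t y ∈ T := fun t => Iff.rfl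
    by_cases hy : y ∈ Set.univ.pi fun _ : Fin n => Metric.closedBall (0 : E) R
    · rw [Set.indicator_of_mem hy]
      set w : Fin (n + 1) → ℂ := fun j => ((l.insertNth (0 : E) y : Fin (n + 1) → E) j : ℂ)
      have hw : ∀ t : E, (fun j => ((l.insertNth t y : Fin (n + 1) → E) j : ℂ)) =
          Function.update w l (t : ℂ) := by
        intro t
        funext j
        rcases Fin.eq_self_or_eq_succAbove l j with rfl | ⟨i, rfl⟩
        · simp
        · simp [w, Fin.succAbove_ne]
      refine (measure_mono fun t ht => ?_).trans (volume_logDeriv_gt_le E (restrictLine l w Q) d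
        ((natDegree_restrictLine_le l w Q).trans hd) c hc)
      have := ((hmem t).mp ht).2
      rw [hw t] at this
      rw [Set.mem_ofPred_eq, derivative_restrictLine, eval_restrictLine, eval_restrictLine]
      exact this
    · rw [Set.indicator_of_notMem hy]
      refine le_of_eq (measure_mono_null (t := ∅) (fun t ht => hy fun j _ => ?_) measure_empty)
      have := ((hmem t).mp ht).1 (l.succAbove j)
      simpa using this
  rw [hvol]
  calc volume (e.symm ⁻¹' T)
      = ∫⁻ y, volume ((fun t => (t, y)) ⁻¹' (e.symm ⁻¹' T)) :=
        Measure.prod_apply_symm (e.symm.measurable hTm)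
    _ ≤ ∫⁻ y, (Set.univ.pi fun _ : Fin n => Metric.closedBall (0 : E) R).indicator
        (fun _ => lineBound E d c) y := lintegral_mono hslice
    _ ≤ lineBound E d c * volume (Set.univ.pi fun _ : Fin n => Metric.closedBall (0 : E) R) :=
        lintegral_indicator_const_le _ _
    _ = boxBound E d (n + 1) R c := by
        rw [volume_pi_pi, Finset.prod_const, Finset.card_univ, Fintype.card_fin, boxBound]
        rfl

/-- If every step of the chain gained at most a factor c, the whole chain would gain at most c to
its length. So the set is covered by one bad set per step. -/
lemma volume_listDeriv_gt_le (E : Submodule ℝ ℂ) {n : ℕ} (Q : MvPolynomial (Fin n) ℂ) (d : ℕ)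
    (hd : Q.totalDegree ≤ d) (R c : ℝ) (hc : 0 < c) (ls : List (Fin n)) :
    volume {z : Fin n → E | (∀ j, ‖z j‖ ≤ R) ∧
      c ^ ls.length * ‖MvPolynomial.eval (fun j => (z j : ℂ)) Q‖ <
        ‖MvPolynomial.eval (fun j => (z j : ℂ)) (listDeriv ls Q)‖} ≤
      ls.length * boxBound E d n R c := by
  induction ls with
  | nil => simp [listDeriv]
  | cons l ls ih =>
    have h := volume_pderiv_gt_le E (listDeriv ls Q) d
      ((totalDegree_listDeriv_le ls Q).trans hd) R c hc l
    have hsum : ((l :: ls).length : ENNReal) * boxBound E d n R c =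
        boxBound E d n R c + ls.length * boxBound E d n R c := by
      push_cast [List.length_cons]; ring
    rw [hsum]
    refine (measure_mono ?_).trans ((measure_union_le _ _).trans (add_le_add h ih))
    rintro z ⟨hz, hlt⟩
    by_contra hnot
    simp only [Set.mem_union, Set.mem_ofPred_eq, not_or, not_and, not_lt] at hnot
    have h1 := hnot.1 hz
    have h2 := hnot.2 hz
    rw [listDeriv_cons, List.length_cons, pow_succ'] at hlt
    refine absurd hlt (not_lt.mpr (h1.trans ?_))
    rw [mul_assoc]
    gcongr

/-! ### The estimate at one place -/

/-- The constant in the sublevel estimate on a real subspace of `ℂ`. -/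
noncomputable def placeConst (E : Submodule ℝ ℂ) (d n : ℕ) (R : ℝ) : ENNReal :=
  volume (Metric.closedBall (0 : E) R) ^ n + d * boxBound E d n R 2⁻¹

lemma placeConst_ne_top (E : Submodule ℝ ℂ) (d n : ℕ) (R : ℝ) : placeConst E d n R ≠ ⊤ := by
  have h (r : ℝ) : volume (Metric.closedBall (0 : E) r) ≠ ⊤ := measure_closedBall_lt_top.ne
  have h1 : boxBound E d n R 2⁻¹ ≠ ⊤ :=
    ENNReal.mul_ne_top (ENNReal.mul_ne_top (ENNReal.natCast_ne_top d)
      (ENNReal.mul_ne_top ENNReal.ofReal_ne_top (h 1))) (ENNReal.pow_ne_top (h R))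
  exact ENNReal.add_ne_top.mpr ⟨ENNReal.pow_ne_top (h R),
    ENNReal.mul_ne_top (ENNReal.natCast_ne_top d) h1⟩

lemma boxBound_scale (E : Submodule ℝ ℂ) (d n : ℕ) (R b : ℝ) (hb : 0 < b) :
    boxBound E d n R (2⁻¹ * b⁻¹) =
      boxBound E d n R 2⁻¹ * ENNReal.ofReal b ^ Module.finrank ℝ E := by
  have : (2 * (d / (2⁻¹ * b⁻¹)) : ℝ) = 2 * (d / 2⁻¹) * b := by field_simp
  rw [boxBound, boxBound, lineBound, lineBound, this, mul_pow,
    ENNReal.ofReal_mul (by positivity), ENNReal.ofReal_pow hb.le]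
  ring

/-- The trivial bound, needed when |α| = 0 and at places below no embedding of S. -/
lemma volume_polydisc_le (E : Submodule ℝ ℂ) (d n : ℕ) (R : ℝ) :
    volume {z : Fin n → E | ∀ j, ‖z j‖ ≤ R} ≤ placeConst E d n R := by
  refine le_trans (le_of_eq ?_) (le_self_add (a := volume (Metric.closedBall (0 : E) R) ^ n))
  have : {z : Fin n → E | ∀ j, ‖z j‖ ≤ R} =
      Set.univ.pi fun _ : Fin n => Metric.closedBall (0 : E) R := by
    ext z; simp
  rw [this, volume_pi_pi, Finset.prod_const, Finset.card_univ, Fintype.card_fin]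

lemma norm_eval_pderiv_le_gradient {n : ℕ} (P : MvPolynomial (Fin n) ℂ) (z : Fin n → ℂ)
    (l : Fin n) : ‖MvPolynomial.eval z (MvPolynomial.pderiv l P)‖ ≤ ‖gradient P z‖ :=
  PiLp.norm_apply_le (gradient P z) l

/-- The sublevel estimate for one polynomial on a real subspace `E` of `ℂ`. -/
lemma volume_gradient_le (E : Submodule ℝ ℂ) {n : ℕ}
    (P : MvPolynomial (Fin n) ℂ) (d : ℕ)
    (hd : P.totalDegree ≤ d) (R : ℝ) (α : Fin n → ℕ) (ε μ : ℝ) (hε : 0 < ε) (hεμ : ε < μ) :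
    volume {z : Fin n → E | (∀ j, ‖z j‖ ≤ R) ∧
      ‖gradient P (fun j => (z j : ℂ))‖ ≤ ε ∧
      μ ≤ ‖MvPolynomial.eval (fun j => (z j : ℂ)) (partialDeriv α P)‖} ≤
      placeConst E d n R *
        (min 1 (ENNReal.ofReal (decayFactor (ε / μ) (∑ l, α l)))) ^ Module.finrank ℝ E := by
  have hμ : 0 < μ := hε.trans hεμ
  have ht : 0 < ε / μ := by positivity
  have ht1 : ε / μ < 1 := (div_lt_one hμ).mpr hεμ
  obtain ⟨ls, hlen, hls⟩ := exists_partialDeriv_eq_listDeriv α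
  rw [← hlen, hls]
  rcases List.eq_nil_or_concat' ls with rfl | ⟨ms, l, rfl⟩
  -- For |α| = 0 the exponent is -1, so the factor is at least 1 and the minimum is 1.
  · have h1 : 1 ≤ decayFactor (ε / μ) 0 := by
      simp only [decayFactor, zero_ne_one, if_false, CharP.cast_eq_zero, zero_sub, div_neg,
        div_one, Real.rpow_neg_one]
      exact (one_le_inv₀ ht).mpr ht1.le
    rw [List.length_nil, min_eq_left (by simpa using h1), one_pow, mul_one]
    exact (measure_mono fun z hz => hz.1).trans (volume_polydisc_le E d n R)
  -- The last entry `l` is the derivative applied first; the gradient bound controls it.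
  · have hQ : listDeriv (ms ++ [l]) P = listDeriv ms (MvPolynomial.pderiv l P) := by
      rw [listDeriv_append]; rfl
    rw [hQ, List.length_append, List.length_singleton]
    by_cases hms : ms.length = 0
    -- For |α| = 1 the conditions give μ ≤ |∂_l P| ≤ ε, against ε < μ, so the set is empty.
    · rw [List.length_eq_zero_iff] at hms
      subst hms
      refine le_of_eq_of_le (measure_mono_null (t := ∅) ?_ measure_empty) zero_le
      rintro z ⟨-, h1, h2⟩
      have h3 := norm_eval_pderiv_le_gradient P (fun j => (z j : ℂ)) l
      have h4 : μ ≤ ‖MvPolynomial.eval (fun j => (z j : ℂ)) (MvPolynomial.pderiv l P)‖ := h2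
      linarith
    set s := ms.length with hs
    set b := decayFactor (ε / μ) (s + 1) with hb
    have hb' : b = (ε / μ) ^ (1 / (s : ℝ)) := by
      simp [hb, decayFactor, hms]
    have hb0 : 0 < b := by rw [hb']; positivity
    have hb1 : b ≤ 1 := by rw [hb']; exact Real.rpow_le_one ht.le ht1.le (by positivity)
    have hbs : b ^ s = ε / μ := by
      rw [hb', one_div, Real.rpow_inv_natCast_pow ht.le hms]
    rw [min_eq_right (by simpa using hb1)]
    by_cases hzero : listDeriv ms (MvPolynomial.pderiv l P) = 0
    · refine le_of_eq_of_le (measure_mono_null (t := ∅) ?_ measure_empty) zero_le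
      rintro z ⟨-, -, h2⟩
      rw [hzero, map_zero, norm_zero] at h2
      linarith
    have hdeg : (MvPolynomial.pderiv l P).totalDegree ≤ d :=
      (totalDegree_listDeriv_le [l] P).trans hd
    have hsd : s ≤ d := by
      have := totalDegree_listDeriv_add_length_le ms _ hzero
      omega
    -- With c = 1/(2b) and b^s = ε/μ, c^s ε = 2^{-s} μ. The factor 1/2 provides the strict
    -- inequality.
    have hmain := volume_listDeriv_gt_le E (MvPolynomial.pderiv l P) d hdeg R
      (2⁻¹ * b⁻¹) (by positivity) ms
    calc _ ≤ _ := measure_mono ?_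
      _ ≤ _ := hmain
      _ ≤ _ := ?_
    · rintro z ⟨hz, h1, h2⟩
      refine ⟨hz, lt_of_lt_of_le ?_ h2⟩
      have h3 := (norm_eval_pderiv_le_gradient P (fun j => (z j : ℂ)) l).trans h1
      have h2s : ((2 : ℝ)⁻¹) ^ s < 1 := pow_lt_one₀ (by norm_num) (by norm_num) hms
      calc (2⁻¹ * b⁻¹) ^ s * _ ≤ (2⁻¹ * b⁻¹) ^ s * ε := by gcongr
        _ = (2 : ℝ)⁻¹ ^ s * μ := by
          rw [mul_pow, inv_pow b, hbs]; field_simp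
        _ < 1 * μ := by gcongr
        _ = μ := one_mul μ
    -- The radius around the roots is proportional to b, whence the power b^{dim E}; the at most d
    -- steps of the chain go into the constant.
    · rw [boxBound_scale E d n R b hb0, placeConst, ← mul_assoc]
      gcongr
      refine le_trans ?_ le_add_self
      gcongr

open NumberField

/-! ### Decomposition over the infinite places -/

open Classical in
/-- The completion at an infinite place as a real subspace of `ℂ`: the real line or all of `ℂ`. -/
noncomputable def placeSpace {K : Type*} [Field K] (w : InfinitePlace K) : Submodule ℝ ℂ :=
  if w.IsReal then Submodule.span ℝ {1} else ⊤

lemma finrank_placeSpace {K : Type*} [Field K] (w : InfinitePlace K) :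
    Module.finrank ℝ (placeSpace w) = w.mult := by
  by_cases h : w.IsReal
  · rw [placeSpace, if_pos h, InfinitePlace.mult, if_pos h]
    exact finrank_span_singleton (one_ne_zero (α := ℂ))
  · rw [placeSpace, if_neg h, InfinitePlace.mult, if_neg h, finrank_top,
      Complex.finrank_real_complex]

section Places

variable {K : Type*} [Field K] [NumberField K] {ι : Type*} [Fintype ι]

lemma sigmaStarStar_mem_placeSpace (B : Module.Basis ι ℚ K) (w : InfinitePlace K)
    (x : ι → ℝ) : sigmaStarStar B w.embedding x ∈ placeSpace w := by
  unfold placeSpace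
  split_ifs with h
  · refine Submodule.sum_mem _ fun j _ => Submodule.mem_span_singleton.mpr
      ⟨x j * (w.embedding_of_isReal h) (B j), ?_⟩
    rw [← InfinitePlace.embedding_of_isReal_apply h]
    simp
  · trivial

lemma sigmaStarStar_add (B : Module.Basis ι ℚ K) (σ : K →+* ℂ) (x y : ι → ℝ) :
    sigmaStarStar B σ (x + y) = sigmaStarStar B σ x + sigmaStarStar B σ y := by
  simp [sigmaStarStar, add_mul, Finset.sum_add_distrib]

lemma sigmaStarStar_smul (B : Module.Basis ι ℚ K) (σ : K →+* ℂ) (c : ℝ) (x : ι → ℝ) :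
    sigmaStarStar B σ (c • x) = c • sigmaStarStar B σ x := by
  simp [sigmaStarStar, Finset.mul_sum, mul_assoc]

lemma sigmaStarStar_conjugate (B : Module.Basis ι ℚ K) (σ : K →+* ℂ) (x : ι → ℝ) :
    sigmaStarStar B (ComplexEmbedding.conjugate σ) x =
      starRingEnd ℂ (sigmaStarStar B σ x) := by
  simp [sigmaStarStar, ComplexEmbedding.conjugate_coe_eq]

/-- The matrix (σ(ω_j)) is invertible because the square of its determinant is the discriminant of
the basis, which is nonzero. -/
lemma eq_zero_of_forall_sigmaStarStar_eq_zero (B : Module.Basis ι ℚ K) (x : ι → ℝ)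
    (h : ∀ σ, sigmaStarStar B σ x = 0) : x = 0 := by
  classical
  have hcard : Fintype.card ι = Fintype.card (K →ₐ[ℚ] ℂ) := by
    rw [AlgHom.card, Module.finrank_eq_card_basis B]
  let e := Fintype.equivOfCardEq hcard
  have hdet : (Algebra.embeddingsMatrixReindex ℚ ℂ B e).det ≠ 0 := by
    intro h0
    have := Algebra.discr_eq_det_embeddingsMatrixReindex_pow_two ℚ ℂ (⇑B) e
    rw [h0, zero_pow two_ne_zero, map_eq_zero] at this
    exact Algebra.discr_not_zero_of_basis ℚ B this
  have hv : Matrix.vecMul (fun j => (x j : ℂ)) (Algebra.embeddingsMatrixReindex ℚ ℂ B e) = 0 := by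
    funext i
    exact h (e i : K →+* ℂ)
  have := Matrix.eq_zero_of_vecMul_eq_zero hdet hv
  funext j
  simpa using congrFun this j

lemma norm_sigmaStarStar_le (B : Module.Basis ι ℚ K) (σ : K →+* ℂ) (x : ι → ℝ)
    (hx : ∀ j, x j ∈ Set.Icc (0 : ℝ) 1) : ‖sigmaStarStar B σ x‖ ≤ ∑ j, ‖σ (B j)‖ := by
  refine (norm_sum_le _ _).trans (Finset.sum_le_sum fun j _ => ?_)
  rw [norm_mul, Complex.norm_real, Real.norm_of_nonneg (hx j).1]
  exact mul_le_of_le_one_left (norm_nonneg _) (hx j).2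

/-- The map sending `x ∈ ℝ^{nk}` to its images at all infinite places. -/
noncomputable def placeMap (B : Module.Basis ι ℚ K) (n : ℕ) :
    (Fin n → ι → ℝ) →ₗ[ℝ] (∀ w : InfinitePlace K, Fin n → placeSpace w) where
  toFun x w l := ⟨sigmaStarStar B w.embedding (x l), sigmaStarStar_mem_placeSpace B w (x l)⟩
  map_add' x y := by
    funext w l
    exact Subtype.ext (sigmaStarStar_add B w.embedding (x l) (y l))
  map_smul' c x := by
    funext w l
    exact Subtype.ext (sigmaStarStar_smul B w.embedding c (x l))

lemma coe_placeMap (B : Module.Basis ι ℚ K) (n : ℕ) (x : Fin n → ι → ℝ) (w : InfinitePlace K) :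
    (fun l => (placeMap B n x w l : ℂ)) = sigmaVec B w.embedding x := rfl

lemma placeMap_injective (B : Module.Basis ι ℚ K) (n : ℕ) :
    Function.Injective (placeMap B n) := by
  rw [injective_iff_map_eq_zero]
  intro x hx
  funext l
  refine eq_zero_of_forall_sigmaStarStar_eq_zero B (x l) fun σ => ?_
  have h : sigmaStarStar B (InfinitePlace.mk σ).embedding (x l) = 0 :=
    congrArg Subtype.val (congrFun (congrFun hx (InfinitePlace.mk σ)) l)
  rcases InfinitePlace.mk_eq_iff.mp (InfinitePlace.mk_embedding (InfinitePlace.mk σ)) with h' | h'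
  · rwa [h'] at h
  · rw [← h', sigmaStarStar_conjugate, h, map_zero]

/-- `placeMap` as a linear isomorphism. -/
noncomputable def placeEquiv (B : Module.Basis ι ℚ K) (n : ℕ) :
    (Fin n → ι → ℝ) ≃L[ℝ] (∀ w : InfinitePlace K, Fin n → placeSpace w) :=
  (LinearEquiv.ofInjectiveOfFinrankEq (placeMap B n) (placeMap_injective B n) (by
    -- Both dimensions are nk, since the local multiplicities sum to k.
    simp only [Module.finrank_pi_fintype, Module.finrank_self, finrank_placeSpace,
      Finset.sum_const, Finset.card_univ, Fintype.card_fin, smul_eq_mul, mul_one]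
    rw [← Finset.mul_sum, InfinitePlace.sum_mult_eq,
      Module.finrank_eq_card_basis B])).toContinuousLinearEquiv

lemma placeEquiv_apply (B : Module.Basis ι ℚ K) (n : ℕ) (x : Fin n → ι → ℝ) :
    placeEquiv B n x = placeMap B n x := rfl

/-- By uniqueness of Haar measure, the pushforward of Lebesgue measure is a multiple of the product
measure; c plays the role of a Jacobian. -/
lemma exists_volume_preimage_placeEquiv (B : Module.Basis ι ℚ K) (n : ℕ) :
    ∃ c : NNReal, ∀ A : ∀ w : InfinitePlace K, Set (Fin n → placeSpace w),
      volume (placeEquiv B n ⁻¹' Set.univ.pi A) = c * ∏ w, volume (A w) := by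
  have (w : InfinitePlace K) : (volume : Measure (Fin n → placeSpace w)).IsAddHaarMeasure :=
    inferInstance
  have : (volume : Measure (∀ w : InfinitePlace K, Fin n → placeSpace w)).IsAddHaarMeasure :=
    Measure.pi.isAddHaarMeasure _
  have hmap : (Measure.map (placeEquiv B n) volume).IsAddHaarMeasure :=
    (placeEquiv B n).isAddHaarMeasure_map volume
  refine ⟨(Measure.map (placeEquiv B n) volume).addHaarScalarFactor volume, fun A => ?_⟩
  have h := Measure.isAddLeftInvariant_eq_smul (Measure.map (placeEquiv B n) volume)
    (volume : Measure (∀ w : InfinitePlace K, Fin n → placeSpace w))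
  have hA : Measure.map (placeEquiv B n) volume (Set.univ.pi A) =
      volume (placeEquiv B n ⁻¹' Set.univ.pi A) :=
    (placeEquiv B n).toHomeomorph.toMeasurableEquiv.map_apply _
  rw [← hA]
  refine (congrArg (fun ν : Measure _ => ν (Set.univ.pi A)) h).trans ?_
  rw [Measure.smul_apply, volume_pi_pi]
  rfl

lemma sigmaVec_conjugate (B : Module.Basis ι ℚ K) {n : ℕ} (σ : K →+* ℂ) (x : Fin n → ι → ℝ) :
    sigmaVec B (ComplexEmbedding.conjugate σ) x =
      fun l => starRingEnd ℂ (sigmaVec B σ x l) :=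
  funext fun l => sigmaStarStar_conjugate B σ (x l)

end Places

/-! ### Conjugate embeddings -/

section Conjugation

variable {n : ℕ}

lemma eval_conj_map (P : MvPolynomial (Fin n) ℂ) (z : Fin n → ℂ) :
    MvPolynomial.eval (fun l => starRingEnd ℂ (z l)) (MvPolynomial.map (starRingEnd ℂ) P) =
      starRingEnd ℂ (MvPolynomial.eval z P) := by
  rw [MvPolynomial.eval_map, MvPolynomial.eval, MvPolynomial.coe_eval₂Hom,
    MvPolynomial.eval₂_comp_left]
  rfl

lemma norm_gradient_conj (P : MvPolynomial (Fin n) ℂ) (z : Fin n → ℂ) :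
    ‖gradient (MvPolynomial.map (starRingEnd ℂ) P) (fun l => starRingEnd ℂ (z l))‖ =
      ‖gradient P z‖ := by
  rw [EuclideanSpace.norm_eq, EuclideanSpace.norm_eq]
  simp only [gradient, MvPolynomial.pderiv_map, eval_conj_map, RCLike.norm_conj]

lemma partialDeriv_map_conj (α : Fin n → ℕ) (P : MvPolynomial (Fin n) ℂ) :
    partialDeriv α (MvPolynomial.map (starRingEnd ℂ) P) =
      MvPolynomial.map (starRingEnd ℂ) (partialDeriv α P) := by
  obtain ⟨ls, -, hls⟩ := exists_partialDeriv_eq_listDeriv α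
  rw [hls, hls]
  clear hls
  induction ls with
  | nil => rfl
  | cons l ls ih => rw [listDeriv_cons, ih, MvPolynomial.pderiv_map]; rfl

variable {K : Type*} [Field K] [NumberField K] {ι : Type*} [Fintype ι] [DecidableEq ι]

lemma totalDegree_polyAt_le (B : Module.Basis ι ℚ K)
    (f : MvPolynomial (Fin n) (realTensor B)) (σ : K →+* ℂ) :
    (polyAt B f σ).totalDegree ≤ f.totalDegree :=
  Finset.sup_mono (MvPolynomial.support_map_subset _ _)

lemma polyAt_conjugate (B : Module.Basis ι ℚ K) (f : MvPolynomial (Fin n) (realTensor B))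
    (σ : K →+* ℂ) :
    polyAt B f (ComplexEmbedding.conjugate σ) =
      MvPolynomial.map (starRingEnd ℂ) (polyAt B f σ) := by
  have h : sigmaStar B (ComplexEmbedding.conjugate σ) =
      (starRingEnd ℂ).comp (sigmaStar B σ) :=
    RingHom.ext fun M => sigmaStarStar_conjugate B σ (coords B M)
  rw [polyAt, polyAt, MvPolynomial.map_map, h]

/-- The norms in the definition of the sublevel set depend only on the place of `σ`. -/
lemma norms_eq_of_mk_eq (B : Module.Basis ι ℚ K) (f : MvPolynomial (Fin n) (realTensor B))
    (x : Fin n → ι → ℝ) (α : Fin n → ℕ) (σ : K →+* ℂ) (w : InfinitePlace K)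
    (hσ : InfinitePlace.mk σ = w) :
    ‖gradient (polyAt B f σ) (sigmaVec B σ x)‖ =
        ‖gradient (polyAt B f w.embedding) (sigmaVec B w.embedding x)‖ ∧
      ‖MvPolynomial.eval (sigmaVec B σ x) (partialDeriv α (polyAt B f σ))‖ =
        ‖MvPolynomial.eval (sigmaVec B w.embedding x)
          (partialDeriv α (polyAt B f w.embedding))‖ := by
  rcases InfinitePlace.mk_eq_iff.mp (hσ.trans w.mk_embedding.symm) with h | h
  · rw [h]; exact ⟨rfl, rfl⟩
  · rw [← h, polyAt_conjugate, sigmaVec_conjugate, norm_gradient_conj, partialDeriv_map_conj,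
      eval_conj_map, RCLike.norm_conj]
    exact ⟨rfl, rfl⟩

end Conjugation

/-! ### Assembling the places -/

lemma decayFactor_nonneg {t : ℝ} (ht : 0 ≤ t) (m : ℕ) : 0 ≤ decayFactor t m := by
  unfold decayFactor
  split_ifs
  · exact le_rfl
  · exact Real.rpow_nonneg ht _

/-- A quantity bounded by the powers of each of several numbers is bounded by their product. -/
lemma le_mul_prod_of_forall_le_mul_pow {τ : Type*} (F : Finset τ) (k : ℕ) (hk : F.card ≤ k)
    (v C : ENNReal) (b : τ → ENNReal) (hC : v ≤ C)
    (h : ∀ i ∈ F, v ≤ C * (min 1 (b i)) ^ k) : v ≤ C * ∏ i ∈ F, b i := by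
  rcases F.eq_empty_or_nonempty with rfl | hF
  · simpa using hC
  · obtain ⟨i, hi, hmin⟩ := F.exists_min_image b hF
    refine (h i hi).trans ?_
    gcongr
    -- Capping at 1 lets the exponent drop from k to the number of factors; then the least b i is
    -- compared with every factor.
    calc min 1 (b i) ^ k ≤ min 1 (b i) ^ F.card :=
          pow_le_pow_of_le_one zero_le (min_le_left _ _) hk
      _ ≤ b i ^ F.card := by gcongr; exact min_le_right _ _
      _ ≤ ∏ j ∈ F, b j := Finset.pow_card_le_prod _ _ _ hmin

end NumberFieldSublevel

open NumberFieldSublevel in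
theorem mainTheorem5 {K : Type*} [Field K] [NumberField K]
    {ι : Type*} [Fintype ι] [DecidableEq ι] (B : Module.Basis ι ℚ K) (d n : ℕ) :
    ∃ C : ℝ, 0 < C ∧
      ∀ (f : MvPolynomial (Fin n) (realTensor B)), f.totalDegree ≤ d →
      ∀ (S : Finset (K →+* ℂ)),
        (∀ σ ∈ S, NumberField.ComplexEmbedding.conjugate σ ∈ S) →
      ∀ (ε μ : (K →+* ℂ) → ℝ), (∀ σ ∈ S, 0 < ε σ ∧ ε σ < μ σ) →
      ∀ (α : (K →+* ℂ) → Fin n → ℕ),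
        MeasureTheory.volume (sublevelSet B f S α ε μ) ≤
          ENNReal.ofReal (C * ∏ σ ∈ S, decayFactor (ε σ / μ σ) (∑ l, α σ l)) := by
  classical
  obtain ⟨c, hc⟩ := exists_volume_preimage_placeEquiv B n
  set R : NumberField.InfinitePlace K → ℝ := fun w => ∑ j, ‖w.embedding (B j)‖ with hR
  set C : ENNReal := c * ∏ w : NumberField.InfinitePlace K, placeConst (placeSpace w) d n (R w)
    with hC
  have hCtop : C ≠ ⊤ := ENNReal.mul_ne_top ENNReal.coe_ne_top
    (ENNReal.prod_ne_top fun w _ => placeConst_ne_top _ d n _)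
  -- The added 1 only ensures positivity.
  refine ⟨C.toReal + 1, by positivity, fun f hf S _ ε μ hεμ α => ?_⟩
  set b : (K →+* ℂ) → ℝ := fun σ => decayFactor (ε σ / μ σ) (∑ l, α σ l) with hb
  have hb0 : ∀ σ ∈ S, 0 ≤ b σ := fun σ hσ => decayFactor_nonneg
    (div_nonneg (hεμ σ hσ).1.le ((hεμ σ hσ).1.trans (hεμ σ hσ).2).le) _
  set F : NumberField.InfinitePlace K → Finset (K →+* ℂ) :=
    fun w => S.filter fun σ => NumberField.InfinitePlace.mk σ = w with hF
  set A : ∀ w : NumberField.InfinitePlace K, Set (Fin n → placeSpace w) := fun w =>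
    {z | (∀ j, ‖z j‖ ≤ R w) ∧ ∀ σ ∈ F w,
      ‖gradient (polyAt B f w.embedding) (fun j => (z j : ℂ))‖ ≤ ε σ ∧
      μ σ ≤ ‖MvPolynomial.eval (fun j => (z j : ℂ))
        (partialDeriv (α σ) (polyAt B f w.embedding))‖} with hA
  have hsub : sublevelSet B f S α ε μ ⊆ placeEquiv B n ⁻¹' Set.univ.pi A := by
    rintro x ⟨hx, hS⟩ w -
    refine ⟨fun j => norm_sigmaStarStar_le B w.embedding (x j) (hx j), fun σ hσ => ?_⟩
    obtain ⟨hσS, hσw⟩ := Finset.mem_filter.mp hσ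
    obtain ⟨h1, h2⟩ := norms_eq_of_mk_eq B f x (α σ) σ w hσw
    rw [placeEquiv_apply, coe_placeMap, ← h1, ← h2]
    exact hS σ hσS
  have hcard : ∀ w, (F w).card ≤ Module.finrank ℝ (placeSpace w) := by
    intro w
    rw [finrank_placeSpace, ← NumberField.InfinitePlace.card_filter_mk_eq]
    exact Finset.card_le_card (Finset.filter_subset_filter _ (Finset.subset_univ S))
  have hplace : ∀ w, MeasureTheory.volume (A w) ≤
      placeConst (placeSpace w) d n (R w) * ∏ σ ∈ F w, ENNReal.ofReal (b σ) := by
    intro w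
    -- At most dim E_w embeddings of S lie over w, and each alone gives a bound with exponent dim
    -- E_w.
    refine le_mul_prod_of_forall_le_mul_pow (F w) _ (hcard w) _ _ _
      ((MeasureTheory.measure_mono fun z hz => hz.1).trans (volume_polydisc_le _ d n _))
      fun σ hσ => ?_
    have hσS := (Finset.mem_filter.mp hσ).1
    exact (MeasureTheory.measure_mono fun z hz => And.intro hz.1 (hz.2 σ hσ)).trans
      (volume_gradient_le (placeSpace w) (polyAt B f w.embedding) d
        ((totalDegree_polyAt_le B f _).trans hf) (R w) (α σ) (ε σ) (μ σ)
        (hεμ σ hσS).1 (hεμ σ hσS).2)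
  calc MeasureTheory.volume (sublevelSet B f S α ε μ)
      ≤ c * ∏ w, MeasureTheory.volume (A w) := (MeasureTheory.measure_mono hsub).trans_eq (hc A)
    _ ≤ c * ∏ w, (placeConst (placeSpace w) d n (R w) * ∏ σ ∈ F w, ENNReal.ofReal (b σ)) := by
        gcongr with w
        exact hplace w
    _ = C * ∏ σ ∈ S, ENNReal.ofReal (b σ) := by
        rw [Finset.prod_mul_distrib, ← mul_assoc,
          Finset.prod_fiberwise S NumberField.InfinitePlace.mk]
    _ = ENNReal.ofReal (C.toReal * ∏ σ ∈ S, b σ) := by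
        rw [ENNReal.ofReal_mul ENNReal.toReal_nonneg, ENNReal.ofReal_toReal hCtop,
          ENNReal.ofReal_prod_of_nonneg hb0]
    _ ≤ _ := by
        refine ENNReal.ofReal_le_ofReal (mul_le_mul_of_nonneg_right ?_ (Finset.prod_nonneg hb0))
        linarith
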